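/- Conventions. Let $\varphi_0,\varphi_1,\dots$ be the standard enumeration of the partial computable functions and $W_e=\operatorname{dom}\varphi_e$. A number $e=\langle i,j\rangle$ is an index of a computable group $G$ if the universe of $G$ is a subset $D\subseteq\mathbb N$ whose characteristic function is $\varphi_i$ (in particular $\varphi_i$ is total), and $\varphi_j(\langle a,b\rangle)=a\cdot_G b$ for all $a,b\in D$. Let $A$ be the set of all indices of computable groups and $B\subseteq A$ the set of indices of nilpotent computable groups. Theorem. Detecting nilpotency is $\Sigma^0_2$-complete in the class of computable groups, that is: (1) there is a $\Sigma^0_2$ set $\Phi\subseteq\mathbb N$ with $B=A\cap\Phi$; (2) for every $\Sigma^0_2$ set $S\subseteq\mathbb N$ there is a computable function $f:\mathbb N\to\mathbb N$ with $f(e)\in A$ for all $e$, such that $e\in S$ if and only if $f(e)\in B$. Moreover, let $W(n)=\mathbb Z_{p_n}\wr\mathbb Z_{p_n}$ (regular wreath product), where $p_n$ is the $n$th prime number ($p_1=2$). There is a computable function $f:\mathbb N\to\mathbb N$ such that for every $e$ the number $f(e)$ is an index of a computable group $G_e$ which is isomorphic to $\mathbb Z\times W(1)\times\cdots\times W(n)$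 if $|W_e|=n<\infty$, and to the direct sum $\mathbb Z\times W(1)\times W(2)\times\cdots$ (sequences with finitely many non-trivial entries) if $W_e$ is infinite; and $G_e$ is nilpotent if and only if $W_e$ is finite. -/

import Mathlib

/-! ### The arithmetical hierarchy -/

/-- The class `Σ⁰ₙ` of subsets of `ℕ`: `Σ⁰₀` consists of the computable sets, and `S` is `Σ⁰ₙ₊₁`
when `x ∈ S ↔ ∃ y, ⟨x, y⟩ ∈ T` for a set `T` that is `Π⁰ₙ`, that is, whose complement is `Σ⁰ₙ`. -/
def SigmaZero : ℕ → Set (Set ℕ)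
  | 0 => {S | ComputablePred fun x => x ∈ S}
  | n + 1 => {S | ∃ T : Set ℕ, Tᶜ ∈ SigmaZero n ∧ ∀ x, x ∈ S ↔ ∃ y, Nat.pair x y ∈ T}

/-! ### Computable groups and their indices -/

/-- `phi e` is the `e`-th partial computable function. -/
def phi (e : ℕ) : ℕ →. ℕ :=
  (Denumerable.ofNat Nat.Partrec.Code e).eval

/-- `W e` is the `e`-th computably enumerable set, the domain of `phi e`. -/
def W (e : ℕ) : Set ℕ :=
  {n | (phi e n).Dom}

/-- An index `e` codes a pair of programs `⟨i, j⟩`: `phi i` is meant to be the characteristic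
function of the universe of the group, a subset of `ℕ`, and `phi j` its multiplication. This is
the universe. -/
def indexUniverse (e : ℕ) : Set ℕ :=
  {n | 1 ∈ phi e.unpair.1 n}

/-- The group structure `G` on the universe given by `e = ⟨i, j⟩` is the one described by `e`:
`phi i` is (total and) the characteristic function of the universe, and `phi j` computes the
multiplication of `G`. (The multiplication determines `G`, so that `e` describes at most one
group.) -/
structure IsIndexOf (e : ℕ) (G : Group (indexUniverse e)) : Prop where
  charFun : ∀ n : ℕ, n ∉ indexUniverse e → 0 ∈ phi e.unpair.1 n
  mul : ∀ a b : indexUniverse e,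
    ((a * b : indexUniverse e) : ℕ) ∈ phi e.unpair.2 (Nat.pair (a : ℕ) (b : ℕ))

/-- The set of all indices of computable groups. -/
def computableGroupIndices : Set ℕ :=
  {e | ∃ G : Group (indexUniverse e), IsIndexOf e G}

/-- The indices of those computable groups that have the property `P`. -/
def indicesWithProperty (P : (G : Type) → [Group G] → Prop) : Set ℕ :=
  {e | ∃ G : Group (indexUniverse e), IsIndexOf e G ∧ P (indexUniverse e)}

/-- Detecting the property `P` is `Γ` in the set `A` of indices of computable groups. -/
def DetectionIn (Γ : Set (Set ℕ)) (A : Set ℕ) (P : (G : Type) → [Group G] → Prop) : Prop :=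
  ∃ Φ ∈ Γ, A ∩ Φ = A ∩ indicesWithProperty P

/-- Detecting the property `P` is `Γ`-hard in the set `A` of indices of computable groups. -/
def DetectionHard (Γ : Set (Set ℕ)) (A : Set ℕ) (P : (G : Type) → [Group G] → Prop) : Prop :=
  ∀ S ∈ Γ, ∃ f : ℕ → ℕ, Computable f ∧ (∀ e, f e ∈ A) ∧
    ∀ e, e ∈ S ↔ f e ∈ A ∩ indicesWithProperty P

/-- Detecting the property `P` is `Γ`-complete in the set `A` of indices of computable groups. -/
def DetectionComplete (Γ : Set (Set ℕ)) (A : Set ℕ) (P : (G : Type) → [Group G] → Prop) : Prop :=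
  DetectionIn Γ A P ∧ DetectionHard Γ A P

/-! ### The groups that witness hardness -/

/-- The direct sum of a family of groups: the subgroup of the full product consisting of the
families that are trivial at all but finitely many indices. -/
def restrictedProduct {ι : Type*} (H : ι → Type*) [∀ i, Group (H i)] :
    Subgroup ((i : ι) → H i) where
  carrier := {f | {i | f i ≠ 1}.Finite}
  one_mem' := by simp
  mul_mem' {f g} hf hg := by
    refine (Set.Finite.union hf hg).subset fun i hi => ?_
    by_contra h
    simp only [Set.mem_union, Set.mem_ofPred_eq, not_or, not_not] at h
    exact hi (by simp [h.1, h.2])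
  inv_mem' {f} hf := by simpa using hf

/-- The cyclic group of order `n`, written multiplicatively. -/
abbrev cyclicGroup (n : ℕ) : Type := Multiplicative (ZMod n)

/-- `wreathFactor k` is the regular wreath product `ℤ_p ≀ ℤ_p`, where `p` is the prime number of
index `k`, counting from `0`: `2, 3, 5, …` for `k = 0, 1, 2, …`. -/
abbrev wreathFactor (k : ℕ) : Type :=
  cyclicGroup (Nat.nth Nat.Prime k) ≀ᵣ cyclicGroup (Nat.nth Nat.Prime k)

/-- `ℤ × ∏_{k < N} wreathFactor k` (restricted product), for `N` in `ℕ ∪ {∞}`. -/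
abbrev wreathSum (N : ℕ∞) : Type :=
  Multiplicative ℤ × restrictedProduct fun k : {k : ℕ // (k : ℕ∞) < N} => wreathFactor k

open Nat.Partrec (Code)
open Encodable Denumerable
open scoped commutatorElement

/-! Upper bound: a group is nilpotent iff for some `n` no iterated commutator `[…[a, b₁], …, bₙ]` is
nontrivial. Given an index, a nontrivial one is certified by finitely many halting computations: `c
= [a, b]` is checked as `ab = c(ba)`, and `a ≠ 1` as `aa ≠ a`, so neither inverses nor the identity
need be found. This gives an `∃∀` condition with decidable matrix (`IsIndexOf.isNilpotent_iff`).

Hardness: finiteness of `W e` is a hard `Σ⁰₂` question (`exists_computable_finite_W_iff`), so it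
suffices to present `ℤ × ⨁ W(k)`, `k < |W e|`, uniformly in `e`. Each `ℤ_p ≀ ℤ_p` is a finite
`p`-group of class at least `p`. Hence a finite sum is nilpotent, while an infinite one has factors
of unbounded class (`isNilpotent_wreathSum_iff`).

For the presentation, a generator carries a stage `s` and a prime `p`, and is trivial unless `s` is
the stage that enumerates the element of `W e` whose position matches that of `p` among the primes.
Two words can differ only at the finitely many primes they mention, where they are compared through
their action on `ℤ_p × ℤ_p`. So equality is decidable although `|W e|` is unknown
(`prod_letter_eq_iff`), and least codes serve as the universe (`exists_computable_isIndexOf`). -/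

theorem ComputablePred.comp {α β : Type*} [Primcodable α] [Primcodable β] {p : β → Prop}
    (hp : ComputablePred p) {f : α → β} (hf : Computable f) : ComputablePred fun a => p (f a) := by
  obtain ⟨_, h⟩ := hp
  exact ⟨fun a => inferInstance, h.comp hf⟩

/-! ### Normal form of `Σ⁰₂` sets -/

/-- The sets in `Σ⁰₂` are those of the form `{x | ∃ y, ∀ z, R x y z}` with `R` computable. -/
theorem mem_sigmaZero_two_iff (S : Set ℕ) : S ∈ SigmaZero 2 ↔
    ∃ R : ℕ → ℕ → ℕ → Prop, (ComputablePred fun q : ℕ × ℕ × ℕ => R q.1 q.2.1 q.2.2) ∧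
      ∀ x, x ∈ S ↔ ∃ y, ∀ z, R x y z := by
  constructor
  · rintro ⟨T, ⟨U, hU, hT⟩, hS⟩
    refine ⟨fun x y z => Nat.pair (Nat.pair x y) z ∈ Uᶜ, ?_, fun x => ?_⟩
    · exact ComputablePred.comp (p := fun x => x ∈ Uᶜ) hU
        (f := fun q : ℕ × ℕ × ℕ => Nat.pair (Nat.pair q.1 q.2.1) q.2.2)
        (Primrec₂.natPair.comp
          (Primrec₂.natPair.comp Primrec.fst (Primrec.fst.comp Primrec.snd))
          (Primrec.snd.comp Primrec.snd)).to_comp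
    · rw [hS]
      refine exists_congr fun y => ?_
      have h := hT (Nat.pair x y)
      rw [Set.mem_compl_iff, not_iff_comm, not_exists] at h
      exact h.symm
  · rintro ⟨R, hR, hS⟩
    refine ⟨{q | ∀ z, R q.unpair.1 q.unpair.2 z},
      ⟨{q | ¬ R q.unpair.1.unpair.1 q.unpair.1.unpair.2 q.unpair.2}, ?_, fun q => ?_⟩, fun x => ?_⟩
    · change ComputablePred fun q : ℕ => q ∈ {q | ¬ _}ᶜ
      simp only [Set.mem_compl_iff, Set.mem_ofPred_eq, not_not]
      exact hR.comp (f := fun q : ℕ => (q.unpair.1.unpair.1, q.unpair.1.unpair.2, q.unpair.2))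
        ((Primrec.fst.comp (Primrec.unpair.comp (Primrec.fst.comp Primrec.unpair))).pair
          ((Primrec.snd.comp (Primrec.unpair.comp (Primrec.fst.comp Primrec.unpair))).pair
          (Primrec.snd.comp Primrec.unpair))).to_comp
    · simp
    · simp [hS]

/-! ### Uniform indices for computably presented groups -/

/-- Uniformly partial computable functions have uniformly computable indices. -/
theorem exists_computable_phi_eq {h : ℕ → ℕ →. ℕ} (hh : Partrec₂ h) :
    ∃ g : ℕ → ℕ, Computable g ∧ ∀ e n, phi (g e) n = h e n := by
  obtain ⟨c, hc⟩ := Code.exists_code.1 (Partrec₂.unpaired'.2 hh)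
  refine ⟨fun e => encode (c.curry e), ?_, fun e n => ?_⟩
  · exact (Primrec.encode.comp
      (Code.primrec₂_curry.comp (Primrec.const c) Primrec.id)).to_comp
  · simp [phi, Code.eval_curry, hc]

/-- A uniformly computable least-number search. -/
theorem exists_computable_least {E : ℕ → ℕ → ℕ → Prop}
    (hE : ComputablePred fun q : ℕ × ℕ × ℕ => E q.1 q.2.1 q.2.2) (hrefl : ∀ e a, E e a a) :
    ∃ l : ℕ → ℕ → ℕ, Computable₂ l ∧ ∀ e a, E e (l e a) a ∧ ∀ b, E e b a → l e a ≤ b := by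
  classical
  have hex : ∀ e a, ∃ b, E e b a := fun e a => ⟨a, hrefl e a⟩
  refine ⟨fun e a => Nat.find (hex e a), ?_,
    fun e a => ⟨Nat.find_spec (hex e a), fun b hb => Nat.find_min' (hex e a) hb⟩⟩
  have hswap : Computable fun r : (ℕ × ℕ) × ℕ => (r.1.1, r.2, r.1.2) :=
    ((Primrec.fst.comp Primrec.fst).pair
      (Primrec.snd.pair (Primrec.snd.comp Primrec.fst))).to_comp
  have hd : Computable₂ fun (q : ℕ × ℕ) (b : ℕ) => decide (E q.1 b q.2) :=
    (hE.comp hswap).decide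
  refine (Partrec.rfind hd.partrec₂).of_eq_tot fun q => ?_
  refine Nat.mem_rfind.2 ⟨?_, fun {m} hm => ?_⟩
  · simpa using Nat.find_spec (hex q.1 q.2)
  · simpa using Nat.find_min (hex q.1 q.2) hm

/-- A uniform family of groups presented by surjections from `ℕ` with computable multiplication
and decidable equality has uniformly computable indices. -/
theorem exists_computable_isIndexOf {G : ℕ → Type*} [∀ e, Group (G e)] (π : ∀ e, ℕ → G e)
    (hπ : ∀ e, Function.Surjective (π e))
    (hE : ComputablePred fun q : ℕ × ℕ × ℕ => π q.1 q.2.1 = π q.1 q.2.2)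
    {m : ℕ → ℕ → ℕ} (hm : Computable₂ m) (hπm : ∀ e a b, π e (m a b) = π e a * π e b) :
    ∃ f : ℕ → ℕ, Computable f ∧ ∀ e, ∃ H : Group (indexUniverse (f e)),
      IsIndexOf (f e) H ∧ Nonempty (indexUniverse (f e) ≃* G e) := by
  -- Each element is represented by its least code; the universe is the set of fixed points of `l`.
  obtain ⟨l, hl, hlE⟩ := exists_computable_least (E := fun e a b => π e a = π e b) hE
    fun _ _ => rfl
  have hli : ∀ e a b, π e a = π e b → l e a = l e b := fun e a b h =>
    le_antisymm ((hlE e a).2 _ ((hlE e b).1.trans h.symm)) ((hlE e b).2 _ ((hlE e a).1.trans h))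
  have hchar : Computable₂ fun e n : ℕ => if l e n = n then 1 else 0 :=
    ((Primrec.ite (Primrec.eq.comp Primrec.fst Primrec.snd) (Primrec.const 1)
      (Primrec.const 0) : Primrec fun q : ℕ × ℕ => if q.1 = q.2 then 1 else 0).to_comp.comp
      (hl.pair Computable.snd))
  have hmul : Computable₂ fun e n : ℕ => l e (m n.unpair.1 n.unpair.2) :=
    hl.comp Computable.fst (hm.comp
      (Primrec.fst.comp (Primrec.unpair.comp Primrec.snd)).to_comp
      (Primrec.snd.comp (Primrec.unpair.comp Primrec.snd)).to_comp)
  obtain ⟨i, hi, hphi⟩ := exists_computable_phi_eq hchar.partrec₂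
  obtain ⟨j, hj, hphj⟩ := exists_computable_phi_eq hmul.partrec₂
  refine ⟨fun e => Nat.pair (i e) (j e), Primrec₂.natPair.to_comp.comp hi hj, fun e => ?_⟩
  have hmem : ∀ n, n ∈ indexUniverse (Nat.pair (i e) (j e)) ↔ l e n = n := fun n => by
    simp only [indexUniverse, Nat.unpair_pair, Set.mem_ofPred_eq, hphi, PFun.coe_val,
      Part.mem_some_iff]
    split_ifs with h <;> simp [h]
  have hll : ∀ a, l e (l e a) = l e a := fun a => hli _ _ _ (hlE e a).1
  let ε : indexUniverse (Nat.pair (i e) (j e)) ≃ G e := Equiv.ofBijective (fun n => π e n) <| by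
    refine ⟨fun a b hab => Subtype.ext ?_, fun g => ?_⟩
    · rw [← (hmem a).1 a.2, ← (hmem b).1 b.2]
      exact hli _ _ _ hab
    · obtain ⟨a, rfl⟩ := hπ e g
      exact ⟨⟨l e a, (hmem _).2 (hll a)⟩, (hlE e a).1⟩
  refine ⟨ε.group, ⟨fun n hn => ?_, fun a b => ?_⟩, ⟨@Equiv.mulEquiv _ _ ε _⟩⟩
  · rw [hmem] at hn
    simp [hphi, hn]
  · have h : ε.symm (ε a * ε b) =
        ⟨l e (m a b), (hmem _).2 (hll _)⟩ := by
      rw [Equiv.symm_apply_eq]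
      exact ((hlE e _).1.trans (hπm e a b)).symm
    change ((ε.symm (ε a * ε b) : indexUniverse _) : ℕ) ∈ _
    rw [h]
    simp [hphj]

/-! ### Nilpotency is `Σ⁰₂`: certified commutators -/

/-- The result of running the `i`-th program on `n` for `k` steps. -/
def phiWithin (k i n : ℕ) : Option ℕ :=
  Code.evaln k (ofNat Code i) n

theorem primrec_phiWithin : Primrec fun q : ℕ × ℕ × ℕ => phiWithin q.1 q.2.1 q.2.2 :=
  Code.primrec_evaln.comp
    ((Primrec.fst.pair ((Primrec.ofNat Code).comp (Primrec.fst.comp Primrec.snd))).pair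
      (Primrec.snd.comp Primrec.snd))

theorem mem_phi_of_phiWithin {k i n v : ℕ} (h : phiWithin k i n = some v) : v ∈ phi i n :=
  Code.evaln_sound h

theorem eventually_phiWithin {i n v : ℕ} (h : v ∈ phi i n) :
    ∀ᶠ k in Filter.atTop, phiWithin k i n = some v := by
  obtain ⟨k, hk⟩ := Code.evaln_complete.1 h
  filter_upwards [Filter.eventually_ge_atTop k] with m hm
  exact Code.evaln_mono hm hk

/-- One step of a chain of commutators, run for `q.2` steps in the group with index `q.1`: `a` is
replaced by `c`, where `(b, c) = r`, if it can be verified that `c` is the commutator of `a`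
and `b`, and by `none` otherwise. -/
def commutatorStep (q : ℕ × ℕ) (a : Option ℕ) (r : ℕ × ℕ) : Option ℕ :=
  -- The last two conditions express `ab = c(ba)`; the `≠ none` excludes agreement by two divergent
  -- computations.
  if phiWithin q.2 q.1.unpair.1 r.1 = some 1 ∧ phiWithin q.2 q.1.unpair.1 r.2 = some 1 ∧
    (a.bind fun a => phiWithin q.2 q.1.unpair.2 (Nat.pair a r.1)) ≠ none ∧
    ((a.bind fun a => phiWithin q.2 q.1.unpair.2 (Nat.pair r.1 a)).bind fun d =>
      phiWithin q.2 q.1.unpair.2 (Nat.pair r.2 d)) =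
    (a.bind fun a => phiWithin q.2 q.1.unpair.2 (Nat.pair a r.1))
  then some r.2 else none

/-- It is verified within `q.2` steps that the number is not the identity of the group with
index `q.1`. -/
def IsNontrivialWithin (q : ℕ × ℕ) (a : Option ℕ) : Prop :=
  (a.bind fun a => phiWithin q.2 q.1.unpair.2 (Nat.pair a a)) ≠ none ∧
    (a.bind fun a => phiWithin q.2 q.1.unpair.2 (Nat.pair a a)) ≠ a

section Primrec

variable {α : Type*} [Primcodable α]

theorem Primrec.phiWithin {k i n : α → ℕ} (hk : Primrec k) (hi : Primrec i) (hn : Primrec n) :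
    Primrec fun a => phiWithin (k a) (i a) (n a) :=
  primrec_phiWithin.comp (hk.pair (hi.pair hn))

theorem Primrec.unpair_fst {f : α → ℕ} (hf : Primrec f) : Primrec fun a => (f a).unpair.1 :=
  Primrec.fst.comp (Primrec.unpair.comp hf)

theorem Primrec.unpair_snd {f : α → ℕ} (hf : Primrec f) : Primrec fun a => (f a).unpair.2 :=
  Primrec.snd.comp (Primrec.unpair.comp hf)

theorem primrec_commutatorStep :
    Primrec fun t : (ℕ × ℕ) × Option ℕ × (ℕ × ℕ) => commutatorStep t.1 t.2.1 t.2.2 := by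
  have he : Primrec fun t : (ℕ × ℕ) × Option ℕ × (ℕ × ℕ) => t.1.1 :=
    Primrec.fst.comp Primrec.fst
  have hk : Primrec fun t : (ℕ × ℕ) × Option ℕ × (ℕ × ℕ) => t.1.2 :=
    Primrec.snd.comp Primrec.fst
  have ha : Primrec fun t : (ℕ × ℕ) × Option ℕ × (ℕ × ℕ) => t.2.1 :=
    Primrec.fst.comp Primrec.snd
  have hb : Primrec fun t : (ℕ × ℕ) × Option ℕ × (ℕ × ℕ) => t.2.2.1 :=
    Primrec.fst.comp (Primrec.snd.comp Primrec.snd)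
  have hc : Primrec fun t : (ℕ × ℕ) × Option ℕ × (ℕ × ℕ) => t.2.2.2 :=
    Primrec.snd.comp (Primrec.snd.comp Primrec.snd)
  have hab := Primrec.option_bind ha (Primrec.phiWithin (hk.comp Primrec.fst)
    (he.comp Primrec.fst).unpair_snd
    (Primrec₂.natPair.comp Primrec.snd (hb.comp Primrec.fst))).to₂
  have hba := Primrec.option_bind ha (Primrec.phiWithin (hk.comp Primrec.fst)
    (he.comp Primrec.fst).unpair_snd
    (Primrec₂.natPair.comp (hb.comp Primrec.fst) Primrec.snd)).to₂
  have hcba := Primrec.option_bind hba (Primrec.phiWithin (hk.comp Primrec.fst)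
    (he.comp Primrec.fst).unpair_snd
    (Primrec₂.natPair.comp (hc.comp Primrec.fst) Primrec.snd)).to₂
  exact Primrec.ite
    ((Primrec.eq.comp (Primrec.phiWithin hk he.unpair_fst hb) (Primrec.const _)).and
      ((Primrec.eq.comp (Primrec.phiWithin hk he.unpair_fst hc) (Primrec.const _)).and
      ((Primrec.eq.comp hab (Primrec.const _)).not.and (Primrec.eq.comp hcba hab))))
    (Primrec.option_some.comp hc) (Primrec.const _)

theorem primrecPred_isNontrivialWithin :
    PrimrecPred fun t : (ℕ × ℕ) × Option ℕ => IsNontrivialWithin t.1 t.2 := by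
  have h : Primrec fun t : (ℕ × ℕ) × Option ℕ =>
      t.2.bind fun a => phiWithin t.1.2 t.1.1.unpair.2 (Nat.pair a a) :=
    Primrec.option_bind Primrec.snd (Primrec.phiWithin
      (Primrec.snd.comp (Primrec.fst.comp Primrec.fst))
      (Primrec.fst.comp (Primrec.fst.comp Primrec.fst)).unpair_snd
      (Primrec₂.natPair.comp Primrec.snd Primrec.snd)).to₂
  exact (Primrec.eq.comp h (Primrec.const none)).not.and (Primrec.eq.comp h Primrec.snd).not

end Primrec

section Semantics

variable {e : ℕ} [G : Group (indexUniverse e)] (hG : IsIndexOf e G)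

include hG

theorem IsIndexOf.eq_mul_of_phiWithin {k v : ℕ} {a b : indexUniverse e}
    (h : phiWithin k e.unpair.2 (Nat.pair a b) = some v) : v = (a * b : indexUniverse e) :=
  Part.mem_unique (mem_phi_of_phiWithin h) (hG.mul a b)

theorem IsIndexOf.isNontrivialWithin_imp {k : ℕ} {a : indexUniverse e}
    (h : IsNontrivialWithin (e, k) (some (a : ℕ))) : a ≠ 1 := by
  rintro rfl
  obtain ⟨h₁, h₂⟩ := h
  simp only [Option.bind_some] at h₁ h₂
  obtain ⟨v, hv⟩ := Option.ne_none_iff_exists'.1 h₁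
  have := hG.eq_mul_of_phiWithin hv
  rw [one_mul] at this
  exact h₂ (this ▸ hv)

theorem IsIndexOf.eventually_isNontrivialWithin {a : indexUniverse e} (h : a ≠ 1) :
    ∀ᶠ k in Filter.atTop, IsNontrivialWithin (e, k) (some (a : ℕ)) := by
  filter_upwards [eventually_phiWithin (hG.mul a a)] with k hk
  simp only [IsNontrivialWithin, Option.bind_some, hk]
  simpa [← Subtype.ext_iff] using h

theorem IsIndexOf.commutatorStep_eq_some {k c : ℕ} {a : indexUniverse e} {r : ℕ × ℕ}
    (h : commutatorStep (e, k) (some (a : ℕ)) r = some c) :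
    ∃ b : indexUniverse e, c = (⁅a, b⁆ : indexUniverse e) := by
  unfold commutatorStep at h
  split_ifs at h with hif
  obtain ⟨hb, hc, h₁, h₂⟩ := hif
  obtain rfl : r.2 = c := by simpa using h
  refine ⟨⟨r.1, mem_phi_of_phiWithin hb⟩, ?_⟩
  have hc' : r.2 ∈ indexUniverse e := mem_phi_of_phiWithin hc
  set b : indexUniverse e := ⟨r.1, mem_phi_of_phiWithin hb⟩ with hbdef
  simp only [Option.bind_some] at h₁ h₂
  obtain ⟨v, hv⟩ := Option.ne_none_iff_exists'.1 h₁
  rw [hv, Option.bind_eq_some_iff] at h₂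
  obtain ⟨d, hd, hdv⟩ := h₂
  have hv' := hG.eq_mul_of_phiWithin (b := b) hv
  have hd' := hG.eq_mul_of_phiWithin (a := b) hd
  subst hd'
  have hw := hG.eq_mul_of_phiWithin (a := ⟨r.2, hc'⟩) hdv
  have : a * b = ⟨r.2, hc'⟩ * (b * a) := Subtype.ext (hv'.symm.trans hw)
  have h3 : (⟨r.2, hc'⟩ : indexUniverse e) = ⁅a, b⁆ := by
    rw [commutatorElement_def, mul_assoc, ← mul_inv_rev, eq_mul_inv_iff_mul_eq, this]
  exact congrArg Subtype.val h3

theorem IsIndexOf.eventually_commutatorStep (a b : indexUniverse e) :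
    ∀ᶠ k in Filter.atTop, commutatorStep (e, k) (some (a : ℕ))
      ((b : ℕ), ((⁅a, b⁆ : indexUniverse e) : ℕ)) = some ((⁅a, b⁆ : indexUniverse e) : ℕ) := by
  filter_upwards [eventually_phiWithin b.2, eventually_phiWithin (⁅a, b⁆ : indexUniverse e).2,
    eventually_phiWithin (hG.mul a b), eventually_phiWithin (hG.mul b a),
    eventually_phiWithin (hG.mul ⁅a, b⁆ (b * a))] with k h₁ h₂ h₃ h₄ h₅
  have : ⁅a, b⁆ * (b * a) = a * b := by rw [commutatorElement_def]; group
  rw [this] at h₅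
  simp [commutatorStep, h₁, h₂, h₃, h₄, h₅]

omit hG in
theorem foldl_commutatorStep_none (q : ℕ × ℕ) (L : List (ℕ × ℕ)) :
    L.foldl (commutatorStep q) none = none := by
  induction L with
  | nil => rfl
  | cons r L ih => simpa [commutatorStep] using ih

/-- A failed check yields `none`, which persists and is never nontrivial. So the fold ends in a true
iterated commutator, and each commutator step lowers the level in the upper central series by one.
-/
theorem IsIndexOf.notMem_upperCentralSeries_of_foldl {k : ℕ} {L : List (ℕ × ℕ)} :
    ∀ {a : indexUniverse e},
      IsNontrivialWithin (e, k) (L.foldl (commutatorStep (e, k)) (some (a : ℕ))) →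
      a ∉ Subgroup.upperCentralSeries (indexUniverse e) L.length := by
  induction L with
  | nil =>
    intro a h
    simpa using hG.isNontrivialWithin_imp h
  | cons r L ih =>
    intro a h ha
    rw [List.foldl_cons] at h
    rcases hs : commutatorStep (e, k) (some (a : ℕ)) r with _ | c
    · rw [hs, foldl_commutatorStep_none] at h
      exact h.1 rfl
    · obtain ⟨b, rfl⟩ := hG.commutatorStep_eq_some hs
      rw [hs] at h
      exact ih h (Subgroup.mem_upperCentralSeries_succ_iff.1 ha b)

/-- At each level some `b` keeps `⁅a, b⁆` outside the next lower term. The finitely many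
computations involved all halt, so one large bound `k` verifies them together. -/
theorem IsIndexOf.exists_foldl_of_notMem_upperCentralSeries {n : ℕ} :
    ∀ {a : indexUniverse e}, a ∉ Subgroup.upperCentralSeries (indexUniverse e) n →
      ∃ L : List (ℕ × ℕ), L.length = n ∧ ∀ᶠ k in Filter.atTop,
        IsNontrivialWithin (e, k) (L.foldl (commutatorStep (e, k)) (some (a : ℕ))) := by
  induction n with
  | zero =>
    intro a h
    exact ⟨[], rfl, hG.eventually_isNontrivialWithin (by simpa using h)⟩
  | succ n ih =>
    intro a h
    rw [Subgroup.mem_upperCentralSeries_succ_iff, not_forall] at h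
    obtain ⟨b, hb⟩ := h
    obtain ⟨L, hL, hk⟩ := ih hb
    refine ⟨((b : ℕ), ((⁅a, b⁆ : indexUniverse e) : ℕ)) :: L, by simp [hL], ?_⟩
    filter_upwards [hk, hG.eventually_commutatorStep a b] with k h₁ h₂
    rwa [List.foldl_cons, h₂]

/-- The right-hand side refers only to the programs coded by `e`, so it makes sense for every number
and does not depend on the chosen group structure. -/
theorem IsIndexOf.isNilpotent_iff : Group.IsNilpotent (indexUniverse e) ↔
    ∃ n, ∀ a k (L : List (ℕ × ℕ)), ¬ (phiWithin k e.unpair.1 a = some 1 ∧ L.length = n ∧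
      IsNontrivialWithin (e, k) (L.foldl (commutatorStep (e, k)) (some a))) := by
  rw [Group.isNilpotent_iff]
  refine exists_congr fun n => ⟨?_, fun h => ?_⟩
  · rintro h a k L ⟨ha, rfl, hL⟩
    exact hG.notMem_upperCentralSeries_of_foldl (a := ⟨a, mem_phi_of_phiWithin ha⟩) hL
      (h ▸ Subgroup.mem_top _)
  · refine eq_top_iff.2 fun a _ => ?_
    by_contra hn
    obtain ⟨L, hL, hk⟩ := hG.exists_foldl_of_notMem_upperCentralSeries hn
    obtain ⟨k, h₁, h₂⟩ := (hk.and (eventually_phiWithin a.2)).exists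
    exact h a k L ⟨h₂, hL, h₁⟩

end Semantics

theorem detectionIn_isNilpotent : DetectionIn (SigmaZero 2) computableGroupIndices
    (fun G [Group G] => Group.IsNilpotent G) := by
  let R : ℕ → ℕ → ℕ × ℕ × List (ℕ × ℕ) → Prop := fun e n t =>
    ¬ (phiWithin t.2.1 e.unpair.1 t.1 = some 1 ∧ t.2.2.length = n ∧
      IsNontrivialWithin (e, t.2.1) (t.2.2.foldl (commutatorStep (e, t.2.1)) (some t.1)))
  have hR : PrimrecPred fun q : ℕ × ℕ × ℕ × ℕ × List (ℕ × ℕ) => R q.1 q.2.1 q.2.2 := by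
    have he : Primrec fun q : ℕ × ℕ × ℕ × ℕ × List (ℕ × ℕ) => q.1 := Primrec.fst
    have hn : Primrec fun q : ℕ × ℕ × ℕ × ℕ × List (ℕ × ℕ) => q.2.1 :=
      Primrec.fst.comp Primrec.snd
    have ha : Primrec fun q : ℕ × ℕ × ℕ × ℕ × List (ℕ × ℕ) => q.2.2.1 :=
      Primrec.fst.comp (Primrec.snd.comp Primrec.snd)
    have hk : Primrec fun q : ℕ × ℕ × ℕ × ℕ × List (ℕ × ℕ) => q.2.2.2.1 :=
      Primrec.fst.comp (Primrec.snd.comp (Primrec.snd.comp Primrec.snd))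
    have hL : Primrec fun q : ℕ × ℕ × ℕ × ℕ × List (ℕ × ℕ) => q.2.2.2.2 :=
      Primrec.snd.comp (Primrec.snd.comp (Primrec.snd.comp Primrec.snd))
    have hfold := Primrec.list_foldl hL (Primrec.option_some.comp ha)
      (primrec_commutatorStep.comp (((he.pair hk).comp Primrec.fst).pair Primrec.snd)).to₂
    exact ((Primrec.eq.comp (Primrec.phiWithin hk he.unpair_fst ha) (Primrec.const _)).and
      ((Primrec.eq.comp (Primrec.list_length.comp hL) hn).and
        (primrecPred_isNontrivialWithin.comp ((he.pair hk).pair hfold)))).not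
  let Φ : Set ℕ := {e | ∃ n, ∀ t, R e n t}
  have key : ∀ {e : ℕ} (G : Group (indexUniverse e)), IsIndexOf e G →
      (e ∈ Φ ↔ Group.IsNilpotent (indexUniverse e)) := fun G hG => by
    simp only [hG.isNilpotent_iff, Φ, R, Prod.forall, Set.mem_ofPred_eq]
  -- The triple `(a, k, L)` is coded by a single number `w`.
  refine ⟨Φ, (mem_sigmaZero_two_iff Φ).2 ⟨fun e n w => R e n (ofNat _ w), ?_, fun e => ?_⟩, ?_⟩
  · exact (hR.comp (Primrec.fst.pair ((Primrec.fst.comp Primrec.snd).pair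
      ((Primrec.ofNat _).comp (Primrec.snd.comp Primrec.snd))))).computablePred
  · refine exists_congr fun n => ⟨fun h w => h _, fun h t => ?_⟩
    have := h (encode t)
    beta_reduce at this
    rwa [Denumerable.ofNat_encode] at this
  · ext e
    refine and_congr_right fun ⟨G, hG⟩ => ⟨fun h => ⟨G, hG, (key G hG).1 h⟩, ?_⟩
    rintro ⟨G', hG', h⟩
    exact (key G' hG').2 h

/-! ### Hardness of finiteness -/

/-- The index set of the finite c.e. sets is hard for `Σ⁰₂`. -/
theorem exists_computable_finite_W_iff {S : Set ℕ} (hS : S ∈ SigmaZero 2) :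
    ∃ g : ℕ → ℕ, Computable g ∧ ∀ e, e ∈ S ↔ (W (g e)).Finite := by
  classical
  obtain ⟨R, hR, hSR⟩ := (mem_sigmaZero_two_iff S).1 hS
  let search : ℕ → ℕ →. ℕ := fun x y => Nat.rfind fun z => Part.some (decide ¬ R x y z)
  have hsearch : Partrec₂ search := by
    have hd : Computable₂ fun (q : ℕ × ℕ) (z : ℕ) => decide ¬ R q.1 q.2 z :=
      (hR.not.comp (f := fun r : (ℕ × ℕ) × ℕ => (r.1.1, r.1.2, r.2))
        ((Primrec.fst.comp Primrec.fst).pair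
          ((Primrec.snd.comp Primrec.fst).pair Primrec.snd)).to_comp).decide
    exact Partrec.rfind hd.partrec₂
  have hdom : ∀ x y, (search x y).Dom ↔ ∃ z, ¬ R x y z := fun x y => by
    rw [Part.dom_iff_mem]
    constructor
    · rintro ⟨z, hz⟩
      exact ⟨z, by simpa using Nat.rfind_spec hz⟩
    · rintro ⟨z, hz⟩
      obtain ⟨z', hz', _⟩ :=
        Nat.rfind_min' (p := fun z => decide ¬ R x y z) (m := z) (by simpa using hz)
      exact ⟨z', hz'⟩
  -- `H x y` halts iff every `y' ≤ y` is refuted as a witness. Its domain is an initial segment,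
  -- finite exactly when some `y` is never refuted.
  let H : ℕ → ℕ →. ℕ := fun x y =>
    y.rec (search x 0) fun y ih => ih.bind fun _ => search x (y + 1)
  have hH : Partrec₂ H := by
    refine Partrec.nat_rec (f := fun q : ℕ × ℕ => q.2) (g := fun q : ℕ × ℕ => search q.1 0)
      (h := fun q p => search q.1 (p.1 + 1)) Computable.snd ?_ ?_
    · exact hsearch.comp Computable.fst (Computable.const 0)
    · exact hsearch.comp (Computable.fst.comp Computable.fst)
        (Computable.succ.comp (Computable.fst.comp Computable.snd))
  have hHdom : ∀ x y, (H x y).Dom ↔ ∀ y' ≤ y, ∃ z, ¬ R x y' z := fun x y => by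
    induction y with
    | zero => simp [H, hdom]
    | succ y ih =>
      have : H x (y + 1) = (H x y).bind fun _ => search x (y + 1) := rfl
      rw [this, Part.bind_dom]
      simp only [exists_prop, ih, hdom, Nat.le_succ_iff, or_imp, forall_and, forall_eq]
  obtain ⟨g, hg, hphi⟩ := exists_computable_phi_eq hH
  refine ⟨g, hg, fun e => ?_⟩
  have hW : W (g e) = {y | ∀ y' ≤ y, ∃ z, ¬ R e y' z} := by
    ext y; simp only [W, hphi, hHdom, Set.mem_ofPred_eq]
  rw [hSR, hW]
  constructor
  · rintro ⟨y, hy⟩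
    refine (Set.finite_lt_nat y).subset fun y' hy' => ?_
    by_contra hlt
    obtain ⟨z, hz⟩ := hy' y (not_lt.1 hlt)
    exact hz (hy z)
  · intro hfin
    by_contra! hcon
    exact Set.infinite_univ (hfin.subset fun y _ y' _ => hcon y')

/-! ### Nilpotency class of `ℤ_p ≀ ℤ_p` -/

section WreathProduct

variable {p : ℕ} [hp : Fact p.Prime]

instance isNilpotent_wreath_cyclicGroup :
    Group.IsNilpotent (cyclicGroup p ≀ᵣ cyclicGroup p) := by
  refine IsPGroup.isNilpotent (p := p) (IsPGroup.of_card (n := p + 1) ?_)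
  rw [RegularWreathProduct.card, Nat.card_congr Multiplicative.toAdd, Nat.card_zmod, pow_succ]

/-- A function on `ℤ_p` whose last nontrivial value, in the order `0, 1, …, p - 1`, is at `n`
gives an element of the wreath product outside the `c`-th term of the upper central series
whenever `n + c < p`. -/
theorem notMem_upperCentralSeries_wreath (c : ℕ) :
    ∀ (n : ℕ) (g : cyclicGroup p → cyclicGroup p), n + c < p →
      g (Multiplicative.ofAdd (n : ZMod p)) ≠ 1 →
      (∀ m, n < m → m < p → g (Multiplicative.ofAdd (m : ZMod p)) = 1) →
      (⟨g, 1⟩ : cyclicGroup p ≀ᵣ cyclicGroup p) ∉ Subgroup.upperCentralSeries _ c := by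
  induction c with
  | zero =>
    intro n g _ hn _ hmem
    rw [Subgroup.upperCentralSeries_zero, Subgroup.mem_bot, RegularWreathProduct.ext_iff] at hmem
    exact hn (congrFun hmem.1 _)
  | succ c ih =>
    intro n g hlt hn hm hmem
    -- Commutation with the translation `t` by `1` turns `g` into `y ↦ g(y) g(y - 1)⁻¹`, whose last
    -- nontrivial value is `g(n)⁻¹`, at `n + 1`; the bound `n + 1 < p` prevents wrapping around.
    let t : cyclicGroup p ≀ᵣ cyclicGroup p := ⟨1, Multiplicative.ofAdd 1⟩
    have hsub : ∀ m : ℕ, (Multiplicative.ofAdd (1 : ZMod p))⁻¹ *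
        Multiplicative.ofAdd ((m + 1 : ℕ) : ZMod p) = Multiplicative.ofAdd (m : ZMod p) :=
      fun m => by rw [← ofAdd_neg, ← ofAdd_add]; push_cast; ring_nf
    have hcomm : ⁅(⟨g, 1⟩ : cyclicGroup p ≀ᵣ cyclicGroup p), t⁆ =
        ⟨fun y => g y * (g ((Multiplicative.ofAdd 1)⁻¹ * y))⁻¹, 1⟩ := by
      rw [commutatorElement_def]
      ext y <;> simp [t]
    have h := Subgroup.mem_upperCentralSeries_succ_iff.1 hmem t
    rw [hcomm] at h
    refine ih (n + 1) _ (by omega) ?_ ?_ h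
    · rw [hsub, hm (n + 1) (by omega) (by omega)]
      simpa using hn
    · intro m hnm hmp
      obtain ⟨m, rfl⟩ : ∃ k, m = k + 1 := ⟨m - 1, by omega⟩
      rw [hsub, hm (m + 1) (by omega) hmp, hm m (by omega) (by omega)]
      simp

/-- A function supported at `0` can be shifted `p - 1` times before wrapping, so it lies outside
every term with `c < p`. -/
theorem le_nilpotencyClass_wreath :
    p ≤ Group.nilpotencyClass (cyclicGroup p ≀ᵣ cyclicGroup p) := by
  classical
  have : NeZero p := ⟨hp.out.ne_zero⟩
  have : Fact (1 < p) := ⟨hp.out.one_lt⟩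
  by_contra! h
  have htop := Subgroup.upperCentralSeries_nilpotencyClass (G := cyclicGroup p ≀ᵣ cyclicGroup p)
  refine notMem_upperCentralSeries_wreath _ 0
    (Pi.mulSingle (Multiplicative.ofAdd (0 : ZMod p)) (Multiplicative.ofAdd (1 : ZMod p)))
    (by simpa using h) ?_ ?_ (htop ▸ Subgroup.mem_top _)
  · simp
  · intro m h0 hm
    refine Pi.mulSingle_eq_of_ne (fun h => ?_) _
    have h' : (m : ZMod p) = 0 := congrArg Multiplicative.toAdd h
    rw [ZMod.natCast_eq_zero_iff] at h'
    exact absurd (Nat.le_of_dvd h0 h') (by omega)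

end WreathProduct

/-! ### Direct sums and their nilpotency -/

section RestrictedProduct

variable {ι : Type*} [DecidableEq ι] {H : ι → Type*} [∀ i, Group (H i)]

theorem mulSingle_mem_restrictedProduct (i : ι) (x : H i) :
    Pi.mulSingle i x ∈ restrictedProduct H :=
  (Set.finite_singleton i).subset fun j hj => by
    by_contra hne
    exact hj (Pi.mulSingle_eq_of_ne hne x)

theorem surjective_eval_restrictedProduct (i : ι) :
    Function.Surjective ((Pi.evalMonoidHom H i).comp (restrictedProduct H).subtype) :=
  fun x => ⟨⟨_, mulSingle_mem_restrictedProduct i x⟩, by simp⟩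

end RestrictedProduct

instance fact_prime_nth (k : ℕ) : Fact (Nat.nth Nat.Prime k).Prime :=
  ⟨Nat.prime_nth_prime k⟩

theorem isNilpotent_wreathSum_iff (N : ℕ∞) : Group.IsNilpotent (wreathSum N) ↔ N ≠ ⊤ := by
  constructor
  · rintro h rfl
    -- The class `k` of the sum also selects a factor: the quotient with index `k` has class at
    -- least its prime, which is at least `k + 2`.
    let k := Group.nilpotencyClass (wreathSum ⊤)
    have hs : Function.Surjective (((Pi.evalMonoidHom _ ⟨k, ENat.natCast_lt_top k⟩).comp
        (restrictedProduct fun k : {k : ℕ // (k : ℕ∞) < ⊤} => wreathFactor k).subtype).comp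
        (MonoidHom.snd (Multiplicative ℤ) _)) :=
      (surjective_eval_restrictedProduct _).comp Prod.snd_surjective
    have h₁ := Group.nilpotencyClass_le_of_surjective _ hs
    have h₂ := le_nilpotencyClass_wreath (p := Nat.nth Nat.Prime k)
    have h₃ : k + 2 ≤ k := (Nat.add_two_le_nth_prime k).trans (h₂.trans h₁)
    omega
  · intro h
    lift N to ℕ using h
    -- Now the restricted product is a subgroup of a finite product of nilpotent groups.
    have : Finite {k : ℕ // (k : ℕ∞) < N} := by
      simp only [Nat.cast_lt]
      exact (Set.finite_lt_nat N).to_subtype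
    infer_instance

/-! ### Stages that enumerate `W e` -/

section Counting

/-- The number `s = ⟨n, t⟩` is a stage at which a new element `n` is found in `W e`: the
computation of `phi e n` halts within `t + 1` but not within `t` steps. -/
def IsNewAt (e s : ℕ) : Prop :=
  phiWithin (s.unpair.2 + 1) e s.unpair.1 ≠ none ∧ phiWithin s.unpair.2 e s.unpair.1 = none

instance (e : ℕ) : DecidablePred (IsNewAt e) := fun _ => inferInstanceAs (Decidable (_ ∧ _))

theorem phiWithin_mono {k₁ k₂ i n : ℕ} (h : k₁ ≤ k₂) (h₁ : phiWithin k₁ i n ≠ none) :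
    phiWithin k₂ i n ≠ none := by
  obtain ⟨v, hv⟩ := Option.ne_none_iff_exists'.1 h₁
  exact Option.ne_none_iff_exists'.2 ⟨v, Nat.Partrec.Code.evaln_mono h hv⟩

theorem phiWithin_zero (i n : ℕ) : phiWithin 0 i n = none := by
  simp [phiWithin, Nat.Partrec.Code.evaln]

/-- Each `n` in `W e` has exactly one new stage, given by its least halting time. -/
theorem encard_isNewAt (e : ℕ) : {s | IsNewAt e s}.encard = (W e).encard := by
  have himage : (fun s : ℕ => s.unpair.1) '' {s | IsNewAt e s} = W e := by
    ext n
    constructor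
    · rintro ⟨s, hs, rfl⟩
      obtain ⟨v, hv⟩ := Option.ne_none_iff_exists'.1 hs.1
      exact Part.dom_iff_mem.2 ⟨v, mem_phi_of_phiWithin hv⟩
    · intro hn
      obtain ⟨v, hv⟩ := Part.dom_iff_mem.1 hn
      obtain ⟨k, hk⟩ := (eventually_phiWithin hv).exists
      have hex : ∃ k, phiWithin k e n ≠ none := ⟨k, by simp [hk]⟩
      -- Nothing halts within `0` steps, so the least halting time is a successor.
      obtain ⟨t, ht⟩ : ∃ t, Nat.find hex = t + 1 := Nat.exists_eq_succ_of_ne_zero fun h0 => by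
        have := Nat.find_spec hex
        rw [h0] at this
        exact this (phiWithin_zero e n)
      refine ⟨Nat.pair n t, ⟨?_, ?_⟩, by simp⟩
      · simpa [← ht] using Nat.find_spec hex
      · simpa using Nat.find_min hex (m := t) (by omega)
  have hinj : Set.InjOn (fun s : ℕ => s.unpair.1) {s | IsNewAt e s} := by
    intro s hs s' hs' hss
    have hle : ∀ {s s' : ℕ}, IsNewAt e s → IsNewAt e s' → s.unpair.1 = s'.unpair.1 →
        s.unpair.2 ≤ s'.unpair.2 := fun {s s'} hs hs' hss => by
      by_contra! hlt
      exact phiWithin_mono (Nat.succ_le_of_lt hlt) (hss ▸ hs'.1) hs.2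
    rw [← Nat.pair_unpair s, ← Nat.pair_unpair s']
    exact congrArg₂ _ hss (le_antisymm (hle hs hs' hss) (hle hs' hs hss.symm))
  rw [← himage, hinj.encard_image]

/-- With `exists_count_eq`, this makes counting earlier stages a computable map from the new stages
onto the indices `k < |W e|`, even though `|W e|` is not computable. -/
theorem count_lt_encard {P : ℕ → Prop} [DecidablePred P] {s : ℕ} (hs : P s) :
    ((Nat.count P s : ℕ) : ℕ∞) < {s | P s}.encard := by
  have h : ((Nat.count P (s + 1) : ℕ) : ℕ∞) ≤ {s | P s}.encard := by
    rw [Nat.count_eq_card_filter_range, ← Set.encard_coe_eq_coe_finsetCard]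
    exact Set.encard_le_encard fun x hx => (Finset.mem_filter.1 (Finset.mem_coe.1 hx)).2
  rw [Nat.count_succ, if_pos hs] at h
  exact lt_of_lt_of_le (by exact_mod_cast Nat.lt_succ_self _) h

theorem exists_count_eq {P : ℕ → Prop} [DecidablePred P] {k : ℕ}
    (hk : (k : ℕ∞) < {s | P s}.encard) : ∃ s, P s ∧ Nat.count P s = k := by
  have h : ∀ hf : (Set.ofPred P).Finite, k < hf.toFinset.card := fun hf => by
    rw [← Nat.cast_lt (α := ℕ∞), ← hf.encard_eq_coe_toFinset_card]
    exact hk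
  exact ⟨Nat.nth P k, Nat.nth_mem k h, Nat.count_nth h⟩

end Counting

/-! ### Generators of the wreath product and their action -/

section WreathLetters

/-- A family of generators of `ℤ_p ≀ ℤ_p`: for `i = 0` the translation by `-c`, and for `i = j + 1`
the function on `ℤ_p` with the value `c` at `j` and no other nonzero value. -/
def wreathLetter (p : ℕ) : ℕ → ℕ → cyclicGroup p ≀ᵣ cyclicGroup p
  | 0, c => ⟨1, Multiplicative.ofAdd (-(c : ZMod p))⟩
  | j + 1, c => ⟨Pi.mulSingle (Multiplicative.ofAdd (j : ZMod p))
      (Multiplicative.ofAdd (c : ZMod p)), 1⟩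

/-- Inverses are not needed, since `c` runs through all residues. A function is a product of its
point values, and `x = (left, 1)(1, right)`. -/
theorem submonoid_eq_top_of_wreathLetter_mem (p : ℕ) [NeZero p]
    (M : Submonoid (cyclicGroup p ≀ᵣ cyclicGroup p)) (hM : ∀ i c, wreathLetter p i c ∈ M) :
    M = ⊤ := by
  refine eq_top_iff.2 fun x _ => ?_
  let inl : (cyclicGroup p → cyclicGroup p) →* cyclicGroup p ≀ᵣ cyclicGroup p :=
    { toFun := fun f => ⟨f, 1⟩
      map_one' := rfl
      map_mul' := fun f g => by ext <;> simp }
  have hval : ∀ z : cyclicGroup p, ∃ c : ℕ, z = Multiplicative.ofAdd (c : ZMod p) := fun z =>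
    ⟨(Multiplicative.toAdd z).val, by simp⟩
  have h₁ : x.left ∈ M.comap inl := by
    have := Fintype.ofEquiv _ (Multiplicative.ofAdd (α := ZMod p))
    rw [← Finset.univ_prod_mulSingle x.left]
    refine Submonoid.prod_mem _ fun z _ => ?_
    obtain ⟨j, hj⟩ := hval z
    obtain ⟨c, hc⟩ := hval (x.left z)
    rw [hc, hj]
    exact hM (j + 1) c
  have h₂ : (⟨1, x.right⟩ : cyclicGroup p ≀ᵣ cyclicGroup p) ∈ M := by
    obtain ⟨c, hc⟩ := hval x.right⁻¹
    rw [inv_eq_iff_eq_inv] at hc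
    rw [hc]
    exact hM 0 c
  have : x = inl x.left * ⟨1, x.right⟩ := by ext <;> simp [inl]
  rw [this]
  exact mul_mem h₁ h₂

/-- The action of a generator on pairs of natural numbers, see `wreathLetter_stepState`. -/
def stepState (p i c : ℕ) (q : ℕ × ℕ) : ℕ × ℕ :=
  if i = 0 then (q.1 + c, q.2) else if q.1 % p = (i - 1) % p then (q.1, q.2 + c) else q

/-- The wreath product acts on the right on pairs by `(x, v) · (f, h) = (h⁻¹x, f(x)v)`, and
`stepState` lifts this to unreduced natural numbers. The sign in the translation letter makes `h⁻¹`
add `c`, so no subtraction of residues arises. -/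
theorem wreathLetter_stepState (p i c : ℕ) (q : ℕ × ℕ) :
    (wreathLetter p i c).left (Multiplicative.ofAdd (q.1 : ZMod p)) *
        Multiplicative.ofAdd (q.2 : ZMod p) =
      Multiplicative.ofAdd ((stepState p i c q).2 : ZMod p) ∧
    (wreathLetter p i c).right⁻¹ * Multiplicative.ofAdd (q.1 : ZMod p) =
      Multiplicative.ofAdd ((stepState p i c q).1 : ZMod p) := by
  rcases i with _ | j
  · simp only [wreathLetter, stepState, if_true, Pi.one_apply, one_mul, true_and]
    rw [← ofAdd_neg, ← ofAdd_add]
    push_cast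
    ring_nf
  · simp only [wreathLetter, stepState, Nat.succ_ne_zero, if_false, Nat.add_sub_cancel, inv_one,
      one_mul]
    by_cases h : q.1 % p = j % p
    · have h' : (q.1 : ZMod p) = j := (ZMod.natCast_eq_natCast_iff _ _ _).2 h
      rw [if_pos h, h', Pi.mulSingle_eq_same, ← ofAdd_add]
      refine ⟨?_, ?_⟩
      · push_cast; ring_nf
      · simp
    · have h' : (q.1 : ZMod p) ≠ j := fun h' => h ((ZMod.natCast_eq_natCast_iff _ _ _).1 h')
      have hne : Multiplicative.ofAdd (q.1 : ZMod p) ≠ Multiplicative.ofAdd (j : ZMod p) :=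
        fun h => h' (congrArg Multiplicative.toAdd h)
      rw [if_neg h, Pi.mulSingle_eq_of_ne hne, one_mul]
      exact ⟨rfl, rfl⟩

end WreathLetters

/-! ### Words and equality in the direct sum -/

section Words

/-- The stage `s` and the prime `p` are matched: at the stage `s`, the `k`-th element of `W e` is
found, and `p` is the `k`-th prime number. -/
def IsMatched (e s p : ℕ) : Prop :=
  -- The prime is part of the data and is only checked, so the condition is decidable without
  -- knowing `|W e|`.
  IsNewAt e s ∧ p.Prime ∧ Nat.count Nat.Prime p = Nat.count (IsNewAt e) s

instance (e s p : ℕ) : Decidable (IsMatched e s p) := inferInstanceAs (Decidable (_ ∧ _ ∧ _))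

/-- The component at `p` of the group element denoted by the letter `(s, p', i, c)`. -/
def letterAt (e p : ℕ) (l : ℕ × ℕ × ℕ × ℕ) : cyclicGroup p ≀ᵣ cyclicGroup p :=
  if IsMatched e l.1 l.2.1 ∧ l.2.1 = p then wreathLetter p l.2.2.1 l.2.2.2 else 1

/-- The action of a letter on pairs of natural numbers. -/
def stepLetter (e p : ℕ) (q : ℕ × ℕ) (l : ℕ × ℕ × ℕ × ℕ) : ℕ × ℕ :=
  if IsMatched e l.1 l.2.1 ∧ l.2.1 = p then stepState p l.2.2.1 l.2.2.2 q else q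

theorem letterAt_stepLetter (e p : ℕ) (q : ℕ × ℕ) (l : ℕ × ℕ × ℕ × ℕ) :
    (letterAt e p l).left (Multiplicative.ofAdd (q.1 : ZMod p)) *
        Multiplicative.ofAdd (q.2 : ZMod p) =
      Multiplicative.ofAdd ((stepLetter e p q l).2 : ZMod p) ∧
    (letterAt e p l).right⁻¹ * Multiplicative.ofAdd (q.1 : ZMod p) =
      Multiplicative.ofAdd ((stepLetter e p q l).1 : ZMod p) := by
  unfold letterAt stepLetter
  split_ifs
  · exact wreathLetter_stepState _ _ _ _
  · simp

theorem prod_letterAt (e p : ℕ) (w : List (ℕ × ℕ × ℕ × ℕ)) : ∀ q : ℕ × ℕ,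
    (w.map (letterAt e p)).prod.left (Multiplicative.ofAdd (q.1 : ZMod p)) *
        Multiplicative.ofAdd (q.2 : ZMod p) =
      Multiplicative.ofAdd ((w.foldl (stepLetter e p) q).2 : ZMod p) ∧
    (w.map (letterAt e p)).prod.right⁻¹ * Multiplicative.ofAdd (q.1 : ZMod p) =
      Multiplicative.ofAdd ((w.foldl (stepLetter e p) q).1 : ZMod p) := by
  induction w with
  | nil => simp
  | cons l w ih =>
    intro q
    obtain ⟨h₁, h₂⟩ := letterAt_stepLetter e p q l
    obtain ⟨h₃, h₄⟩ := ih (stepLetter e p q l)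
    rw [List.map_cons, List.prod_cons, List.foldl_cons, RegularWreathProduct.mul_left,
      RegularWreathProduct.mul_right]
    constructor
    · rw [← h₃, ← h₁, ← h₂, Pi.mul_apply, mul_left_comm, mul_assoc, mul_left_comm]
    · rw [← h₄, ← h₂, mul_inv_rev, mul_assoc]

/-- The words `w` and `w'` have the same action, modulo `p`, on the pairs `(x, 0)`. -/
def SameAction (e p : ℕ) (w w' : List (ℕ × ℕ × ℕ × ℕ)) : Prop :=
  ∀ x < p,
    (w.foldl (stepLetter e p) (x, 0)).1 % p = (w'.foldl (stepLetter e p) (x, 0)).1 % p ∧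
    (w.foldl (stepLetter e p) (x, 0)).2 % p = (w'.foldl (stepLetter e p) (x, 0)).2 % p

/-- The action is faithful: starting from `(x, 0)`, the second coordinate gives `left` at `x`, and
the first determines `right`. -/
theorem sameAction_iff (e p : ℕ) [NeZero p] (w w' : List (ℕ × ℕ × ℕ × ℕ)) :
    SameAction e p w w' ↔ (w.map (letterAt e p)).prod = (w'.map (letterAt e p)).prod := by
  have key : ∀ a b : ℕ, a % p = b % p ↔
      Multiplicative.ofAdd (a : ZMod p) = Multiplicative.ofAdd (b : ZMod p) := fun a b =>
    ((ZMod.natCast_eq_natCast_iff a b p).symm).trans Multiplicative.ofAdd.injective.eq_iff.symm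
  have key' : ∀ x : ℕ, _ := fun x => prod_letterAt e p w (x, 0)
  have key'' : ∀ x : ℕ, _ := fun x => prod_letterAt e p w' (x, 0)
  simp only [SameAction, key, ← (key' _).1, ← (key' _).2, ← (key'' _).1, ← (key'' _).2,
    mul_left_inj, inv_inj]
  constructor
  · intro h
    refine RegularWreathProduct.ext ?_ (h 0 (NeZero.pos p)).1
    funext z
    have := (h (Multiplicative.toAdd z).val (ZMod.val_lt _)).2
    simpa using this
  · intro h x _
    rw [h]
    exact ⟨rfl, rfl⟩

/-- The element of the direct sum denoted by a letter. -/
noncomputable def letter (e : ℕ) (l : ℕ × ℕ × ℕ × ℕ) :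
    restrictedProduct fun k : {k : ℕ // (k : ℕ∞) < (W e).encard} => wreathFactor k :=
  ⟨fun k => letterAt e (Nat.nth Nat.Prime k) l, by
    -- Only the component of the prime named in the letter can be nontrivial.
    refine Set.Subsingleton.finite fun k hk k' hk' => ?_
    have h : ∀ {p}, letterAt e p l ≠ 1 → l.2.1 = p := fun {p} hp => by
      by_contra h
      exact hp (if_neg fun h' => h h'.2)
    exact Subtype.ext (Nat.nth_injective Nat.infinite_setOfPred_prime
      ((h hk).symm.trans (h hk')))⟩

theorem coe_prod_letter (e : ℕ) (w : List (ℕ × ℕ × ℕ × ℕ))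
    (k : {k : ℕ // (k : ℕ∞) < (W e).encard}) :
    ((w.map (letter e)).prod : (k : {k : ℕ // (k : ℕ∞) < (W e).encard}) → wreathFactor k) k =
      (w.map (letterAt e (Nat.nth Nat.Prime k))).prod := by
  have h := map_list_prod ((Pi.evalMonoidHom _ k).comp (restrictedProduct
    fun k : {k : ℕ // (k : ℕ∞) < (W e).encard} => wreathFactor k).subtype) (w.map (letter e))
  rw [List.map_map] at h
  exact h

/-- At a prime not named by a matched letter of `w` or `w'`, both products are trivial. This
replaces a comparison over an unknown set of components by a finite check. -/
theorem prod_letter_eq_iff (e : ℕ) (w w' : List (ℕ × ℕ × ℕ × ℕ)) :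
    (w.map (letter e)).prod = (w'.map (letter e)).prod ↔
      ∀ l ∈ w ++ w', IsMatched e l.1 l.2.1 → SameAction e l.2.1 w w' := by
  have hne : ∀ k, NeZero (Nat.nth Nat.Prime k) := fun k => ⟨(Nat.prime_nth_prime k).ne_zero⟩
  have h : (w.map (letter e)).prod = (w'.map (letter e)).prod ↔
      ∀ k : ℕ, (k : ℕ∞) < (W e).encard → SameAction e (Nat.nth Nat.Prime k) w w' := by
    simp only [Subtype.ext_iff, funext_iff, coe_prod_letter, Subtype.forall, sameAction_iff]
  rw [h]
  constructor
  · intro h l _ hl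
    have hk := h (Nat.count Nat.Prime l.2.1) (by
      rw [hl.2.2, ← encard_isNewAt]
      exact count_lt_encard hl.1)
    rwa [Nat.nth_count hl.2.1] at hk
  · intro h k _
    by_cases hk : ∃ l ∈ w ++ w', IsMatched e l.1 l.2.1 ∧ l.2.1 = Nat.nth Nat.Prime k
    · obtain ⟨l, hl, hm, hp⟩ := hk
      exact hp ▸ h l hl hm
    · have h1 : ∀ l ∈ w ++ w', letterAt e (Nat.nth Nat.Prime k) l = 1 := fun l hl =>
        if_neg fun h => hk ⟨l, hl, h⟩
      rw [sameAction_iff, List.prod_eq_one, List.prod_eq_one]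
      · exact List.forall_mem_map.2 fun l hl => h1 l (List.mem_append_right _ hl)
      · exact List.forall_mem_map.2 fun l hl => h1 l (List.mem_append_left _ hl)

/-- Induction on a finite set containing the support, splitting off one coordinate at a time. -/
theorem submonoid_eq_top_of_mulSingle_mem {ι : Type*} [DecidableEq ι] {H : ι → Type*}
    [∀ i, Group (H i)] (M : Submonoid (restrictedProduct H))
    (hM : ∀ i x, (⟨Pi.mulSingle i x, mulSingle_mem_restrictedProduct i x⟩ :
      restrictedProduct H) ∈ M) : M = ⊤ := by
  have key : ∀ (s : Finset ι) (f : restrictedProduct H), (∀ i ∉ s, f.1 i = 1) → f ∈ M := by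
    intro s
    induction s using Finset.induction_on with
    | empty =>
      intro f hf
      have : f = 1 := Subtype.ext (funext fun i => hf i (by simp))
      exact this ▸ one_mem M
    | insert i s hi ih =>
      intro f hf
      let g : restrictedProduct H := ⟨Pi.mulSingle i (f.1 i), mulSingle_mem_restrictedProduct i _⟩
      have hg : g⁻¹ * f ∈ M := ih _ fun j hj => by
        change (Pi.mulSingle i (f.1 i) j)⁻¹ * f.1 j = 1
        rcases eq_or_ne j i with rfl | hji
        · simp
        · rw [Pi.mulSingle_eq_of_ne hji, hf j (by simp [hji, hj])]
          simp
      exact mul_inv_cancel_left g f ▸ mul_mem (hM i (f.1 i)) hg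
  exact eq_top_iff.2 fun f _ => key f.2.toFinset f fun i hi => by
    by_contra h
    exact hi ((Set.Finite.mem_toFinset f.2).2 h)

theorem exists_prod_letter_eq (e : ℕ)
    (x : restrictedProduct fun k : {k : ℕ // (k : ℕ∞) < (W e).encard} => wreathFactor k) :
    ∃ w : List (ℕ × ℕ × ℕ × ℕ), (w.map (letter e)).prod = x := by
  have hne : ∀ k, NeZero (Nat.nth Nat.Prime k) := fun k => ⟨(Nat.prime_nth_prime k).ne_zero⟩
  have htop : MonoidHom.mrange (FreeMonoid.lift (letter e)) = ⊤ := by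
    refine submonoid_eq_top_of_mulSingle_mem _ fun k x => ?_
    let single : wreathFactor k →*
        restrictedProduct fun k : {k : ℕ // (k : ℕ∞) < (W e).encard} => wreathFactor k :=
      (MonoidHom.mulSingle (fun k : {k : ℕ // (k : ℕ∞) < (W e).encard} => wreathFactor k)
        k).codRestrict _ fun x => mulSingle_mem_restrictedProduct
          (H := fun k : {k : ℕ // (k : ℕ∞) < (W e).encard} => wreathFactor k) k x
    have := submonoid_eq_top_of_wreathLetter_mem (Nat.nth Nat.Prime k)
      ((MonoidHom.mrange (FreeMonoid.lift (letter e))).comap single) fun i c => by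
        -- Since `k < |W e|`, some new stage `s` has count `k`; it matches the prime of index `k`
        -- and so activates the generators of that factor.
        obtain ⟨s, hs, hsk⟩ := exists_count_eq (P := IsNewAt e) (k := k)
          (by rw [encard_isNewAt]; exact k.2)
        refine ⟨FreeMonoid.of (s, Nat.nth Nat.Prime k, i, c), ?_⟩
        rw [FreeMonoid.lift_eval_of]
        refine Subtype.ext (funext fun k' => ?_)
        change letterAt e (Nat.nth Nat.Prime k') (s, Nat.nth Nat.Prime k, i, c) =
          (Pi.mulSingle k (wreathLetter (Nat.nth Nat.Prime k) i c) :
            (k : {k : ℕ // (k : ℕ∞) < (W e).encard}) → wreathFactor k) k'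
        rcases eq_or_ne k' k with rfl | hk
        · rw [Pi.mulSingle_eq_same]
          exact if_pos ⟨⟨hs, Nat.prime_nth_prime _, by rw [Nat.count_nth_of_infinite
            Nat.infinite_setOfPred_prime, hsk]⟩, rfl⟩
        · rw [Pi.mulSingle_eq_of_ne hk]
          exact if_neg fun h => hk (Subtype.ext
            (Nat.nth_injective Nat.infinite_setOfPred_prime h.2.symm))
    exact (this ▸ Submonoid.mem_top x : x ∈ Submonoid.comap single _)
  obtain ⟨w, rfl⟩ := (htop ▸ Submonoid.mem_top x : x ∈ MonoidHom.mrange _)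
  exact ⟨w.toList, (FreeMonoid.lift_apply _ _).symm⟩

end Words

/-! ### Primitive recursiveness of the word comparison -/

section Primrec

variable {α : Type*} [Primcodable α]

theorem PrimrecRel.count {R : α → ℕ → Prop} [∀ a, DecidablePred (R a)] (hR : PrimrecRel R) :
    Primrec₂ fun a n => Nat.count (R a) n := by
  refine (Primrec.nat_rec (f := fun _ : α => 0)
    (g := fun a (q : ℕ × ℕ) => q.2 + if R a q.1 then 1 else 0) (Primrec.const 0) ?_).of_eq
    fun a n => ?_
  · exact Primrec.nat_add.comp (Primrec.snd.comp Primrec.snd)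
      (Primrec.ite (hR.comp Primrec.fst (Primrec.fst.comp Primrec.snd)) (Primrec.const 1)
        (Primrec.const 0))
  · induction n with
    | zero => rfl
    | succ n ih => rw [Nat.count_succ, ← ih]

theorem primrecPred_prime : PrimrecPred Nat.Prime := by
  have h : PrimrecRel fun m p : ℕ => p % m = 0 → m = 1 :=
    ((Primrec.eq.comp (Primrec.nat_mod.comp Primrec.snd Primrec.fst) (Primrec.const 0)).not.or
      (Primrec.eq.comp Primrec.fst (Primrec.const 1))).of_eq fun _ => imp_iff_not_or.symm
  refine ((Primrec.nat_le.comp (Primrec.const 2) Primrec.id).and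
    (h.forall_lt.comp Primrec.id Primrec.id)).of_eq fun p => ?_
  rw [Nat.prime_def_lt]
  simp [Nat.dvd_iff_mod_eq_zero]

theorem primrecRel_isNewAt : PrimrecRel IsNewAt :=
  (Primrec.eq.comp (Primrec.phiWithin (Primrec.succ.comp Primrec.snd.unpair_snd) Primrec.fst
    Primrec.snd.unpair_fst) (Primrec.const none)).not.and
  (Primrec.eq.comp (Primrec.phiWithin Primrec.snd.unpair_snd Primrec.fst
    Primrec.snd.unpair_fst) (Primrec.const none))

theorem primrecPred_isMatched {e s p : α → ℕ} (he : Primrec e) (hs : Primrec s) (hp : Primrec p) :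
    PrimrecPred fun a => IsMatched (e a) (s a) (p a) := by
  have hcount : Primrec₂ fun (_ : ℕ) n => Nat.count Nat.Prime n :=
    PrimrecRel.count (R := fun (_ : ℕ) p => Nat.Prime p) (primrecPred_prime.comp Primrec.snd)
  exact (primrecRel_isNewAt.comp he hs).and ((primrecPred_prime.comp hp).and
    (Primrec.eq.comp (hcount.comp (Primrec.const 0) hp) (primrecRel_isNewAt.count.comp he hs)))

theorem primrec_stepLetter : Primrec fun t : (ℕ × ℕ) × (ℕ × ℕ) × (ℕ × ℕ × ℕ × ℕ) =>
    stepLetter t.1.1 t.1.2 t.2.1 t.2.2 := by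
  have he : Primrec fun t : (ℕ × ℕ) × (ℕ × ℕ) × (ℕ × ℕ × ℕ × ℕ) => t.1.1 :=
    Primrec.fst.comp Primrec.fst
  have hp : Primrec fun t : (ℕ × ℕ) × (ℕ × ℕ) × (ℕ × ℕ × ℕ × ℕ) => t.1.2 :=
    Primrec.snd.comp Primrec.fst
  have hq : Primrec fun t : (ℕ × ℕ) × (ℕ × ℕ) × (ℕ × ℕ × ℕ × ℕ) => t.2.1 :=
    Primrec.fst.comp Primrec.snd
  have hl : Primrec fun t : (ℕ × ℕ) × (ℕ × ℕ) × (ℕ × ℕ × ℕ × ℕ) => t.2.2 :=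
    Primrec.snd.comp Primrec.snd
  have hlp := Primrec.fst.comp (Primrec.snd.comp hl)
  have hli := Primrec.fst.comp (Primrec.snd.comp (Primrec.snd.comp hl))
  have hlc := Primrec.snd.comp (Primrec.snd.comp (Primrec.snd.comp hl))
  refine Primrec.ite ((primrecPred_isMatched he (Primrec.fst.comp hl) hlp).and
    (Primrec.eq.comp hlp hp)) ?_ hq
  exact Primrec.ite (Primrec.eq.comp hli (Primrec.const 0))
    ((Primrec.nat_add.comp (Primrec.fst.comp hq) hlc).pair (Primrec.snd.comp hq))
    (Primrec.ite (Primrec.eq.comp (Primrec.nat_mod.comp (Primrec.fst.comp hq) hp)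
      (Primrec.nat_mod.comp (Primrec.nat_sub.comp hli (Primrec.const 1)) hp))
      ((Primrec.fst.comp hq).pair (Primrec.nat_add.comp (Primrec.snd.comp hq) hlc)) hq)

theorem primrecPred_sameAction {e p : α → ℕ} {w w' : α → List (ℕ × ℕ × ℕ × ℕ)} (he : Primrec e)
    (hp : Primrec p) (hw : Primrec w) (hw' : Primrec w') :
    PrimrecPred fun a => SameAction (e a) (p a) (w a) (w' a) := by
  have hfold : ∀ {v : α → List (ℕ × ℕ × ℕ × ℕ)}, Primrec v → Primrec fun t : ℕ × α =>
      (v t.2).foldl (stepLetter (e t.2) (p t.2)) (t.1, 0) := fun hv =>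
    Primrec.list_foldl (hv.comp Primrec.snd) (Primrec.fst.pair (Primrec.const 0))
      (primrec_stepLetter.comp (((he.pair hp).comp (Primrec.snd.comp Primrec.fst)).pair
        Primrec.snd)).to₂
  have hp' : Primrec fun t : ℕ × α => p t.2 := hp.comp Primrec.snd
  have hR : PrimrecRel fun (x : ℕ) (a : α) =>
      ((w a).foldl (stepLetter (e a) (p a)) (x, 0)).1 % p a =
        ((w' a).foldl (stepLetter (e a) (p a)) (x, 0)).1 % p a ∧
      ((w a).foldl (stepLetter (e a) (p a)) (x, 0)).2 % p a =
        ((w' a).foldl (stepLetter (e a) (p a)) (x, 0)).2 % p a :=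
    (Primrec.eq.comp (Primrec.nat_mod.comp (Primrec.fst.comp (hfold hw)) hp')
      (Primrec.nat_mod.comp (Primrec.fst.comp (hfold hw')) hp')).and
    (Primrec.eq.comp (Primrec.nat_mod.comp (Primrec.snd.comp (hfold hw)) hp')
      (Primrec.nat_mod.comp (Primrec.snd.comp (hfold hw')) hp'))
  exact (hR.forall_mem_list.comp (Primrec.list_range.comp hp) Primrec.id).of_eq fun a => by
    simp only [List.mem_range, SameAction, id]

end Primrec

/-! ### The computable presentation and the main theorem -/

/-- The codes of the elements of `wreathSum (W e).encard`: the triple `(a, b, w)` stands for the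
integer `a - b` and the word `w`. -/
abbrev ElementCode : Type := ℕ × ℕ × List (ℕ × ℕ × ℕ × ℕ)

/-- The element with a given code. -/
noncomputable def ofElementCode (e : ℕ) (t : ElementCode) : wreathSum (W e).encard :=
  (Multiplicative.ofAdd ((t.1 : ℤ) - t.2.1), (t.2.2.map (letter e)).prod)

/-- The product of two codes. -/
def ElementCode.mul (t t' : ElementCode) : ElementCode :=
  (t.1 + t'.1, t.2.1 + t'.2.1, t.2.2 ++ t'.2.2)

theorem ofElementCode_mul (e : ℕ) (t t' : ElementCode) :
    ofElementCode e (t.mul t') = ofElementCode e t * ofElementCode e t' := by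
  refine Prod.ext ?_ ?_
  · simp only [ofElementCode, ElementCode.mul, Prod.fst_mul, ← ofAdd_add]
    push_cast
    ring_nf
  · simp [ofElementCode, ElementCode.mul]

theorem ofElementCode_surjective (e : ℕ) : Function.Surjective (ofElementCode e) := by
  rintro ⟨z, x⟩
  obtain ⟨w, rfl⟩ := exists_prod_letter_eq e x
  -- An integer is the difference of its positive and negative parts.
  refine ⟨((Multiplicative.toAdd z).toNat, (-Multiplicative.toAdd z).toNat, w), ?_⟩
  simp [ofElementCode]

theorem ofElementCode_eq_iff (e : ℕ) (t t' : ElementCode) :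
    ofElementCode e t = ofElementCode e t' ↔ t.1 + t'.2.1 = t'.1 + t.2.1 ∧
      ∀ l ∈ t.2.2 ++ t'.2.2, IsMatched e l.1 l.2.1 → SameAction e l.2.1 t.2.2 t'.2.2 := by
  rw [← prod_letter_eq_iff, ofElementCode, ofElementCode, Prod.mk.injEq,
    Multiplicative.ofAdd.injective.eq_iff]
  exact and_congr_left fun _ => by omega

theorem primrecPred_ofElementCode_eq :
    PrimrecPred fun q : ℕ × ElementCode × ElementCode =>
      ofElementCode q.1 q.2.1 = ofElementCode q.1 q.2.2 := by
  simp only [ofElementCode_eq_iff]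
  have ht : Primrec fun q : ℕ × ElementCode × ElementCode => q.2.1 :=
    Primrec.fst.comp Primrec.snd
  have ht' : Primrec fun q : ℕ × ElementCode × ElementCode => q.2.2 :=
    Primrec.snd.comp Primrec.snd
  have hw := Primrec.snd.comp (Primrec.snd.comp ht)
  have hw' := Primrec.snd.comp (Primrec.snd.comp ht')
  have hl : Primrec fun r : (ℕ × ℕ × ℕ × ℕ) × ℕ × ElementCode × ElementCode => r.1.2.1 :=
    Primrec.fst.comp (Primrec.snd.comp Primrec.fst)
  have hR : PrimrecRel fun (l : ℕ × ℕ × ℕ × ℕ) (q : ℕ × ElementCode × ElementCode) =>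
      IsMatched q.1 l.1 l.2.1 → SameAction q.1 l.2.1 q.2.1.2.2 q.2.2.2.2 :=
    ((primrecPred_isMatched (Primrec.fst.comp Primrec.snd) (Primrec.fst.comp Primrec.fst)
      hl).not.or (primrecPred_sameAction (Primrec.fst.comp Primrec.snd) hl
        (hw.comp Primrec.snd) (hw'.comp Primrec.snd))).of_eq fun _ => imp_iff_not_or.symm
  exact (Primrec.eq.comp
    (Primrec.nat_add.comp (Primrec.fst.comp ht) (Primrec.fst.comp (Primrec.snd.comp ht')))
    (Primrec.nat_add.comp (Primrec.fst.comp ht') (Primrec.fst.comp (Primrec.snd.comp ht)))).and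
    (hR.forall_mem_list.comp (Primrec.list_append.comp hw hw') Primrec.id)

theorem primrec_elementCode_mul : Primrec₂ ElementCode.mul := by
  have ht : Primrec fun q : ElementCode × ElementCode => q.1 := Primrec.fst
  have ht' : Primrec fun q : ElementCode × ElementCode => q.2 := Primrec.snd
  exact (Primrec.nat_add.comp (Primrec.fst.comp ht) (Primrec.fst.comp ht')).pair
    ((Primrec.nat_add.comp (Primrec.fst.comp (Primrec.snd.comp ht))
      (Primrec.fst.comp (Primrec.snd.comp ht'))).pair
    (Primrec.list_append.comp (Primrec.snd.comp (Primrec.snd.comp ht))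
      (Primrec.snd.comp (Primrec.snd.comp ht'))))

theorem exists_computable_index_wreathSum : ∃ f : ℕ → ℕ, Computable f ∧
    ∀ e : ℕ, ∃ G : Group (indexUniverse (f e)), IsIndexOf (f e) G ∧
      Nonempty (indexUniverse (f e) ≃* wreathSum (W e).encard) ∧
      (Group.IsNilpotent (indexUniverse (f e)) ↔ (W e).Finite) := by
  have hofNat : Primrec (ofNat ElementCode) := Primrec.ofNat ElementCode
  obtain ⟨f, hf, h⟩ := exists_computable_isIndexOf
    (fun e n => ofElementCode e (ofNat ElementCode n))
    (fun e => (ofElementCode_surjective e).comp fun t => ⟨encode t, Denumerable.ofNat_encode t⟩)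
    (primrecPred_ofElementCode_eq.comp (Primrec.fst.pair
      ((hofNat.comp (Primrec.fst.comp Primrec.snd)).pair
        (hofNat.comp (Primrec.snd.comp Primrec.snd))))).computablePred
    -- Multiplication of codes is the same for all `e`; only equality of codes depends on `W e`.
    (m := fun a b => encode ((ofNat ElementCode a).mul (ofNat ElementCode b)))
    (Primrec.encode.comp (primrec_elementCode_mul.comp (hofNat.comp Primrec.fst)
      (hofNat.comp Primrec.snd))).to_comp
    (fun e a b => by rw [Denumerable.ofNat_encode, ofElementCode_mul])
  refine ⟨f, hf, fun e => ?_⟩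
  obtain ⟨G, hG, ⟨φ⟩⟩ := h e
  refine ⟨G, hG, ⟨φ⟩, ?_⟩
  rw [Group.isNilpotent_congr φ, isNilpotent_wreathSum_iff, Set.encard_ne_top_iff]

theorem mainTheorem9 :
    DetectionComplete (SigmaZero 2) computableGroupIndices (fun G [Group G] => Group.IsNilpotent G) ∧
    ∃ f : ℕ → ℕ, Computable f ∧ ∀ e : ℕ, ∃ G : Group (indexUniverse (f e)), IsIndexOf (f e) G ∧
      Nonempty (indexUniverse (f e) ≃* wreathSum (W e).encard) ∧
      (Group.IsNilpotent (indexUniverse (f e)) ↔ (W e).Finite) := by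
  refine ⟨⟨detectionIn_isNilpotent, fun S hS => ?_⟩, exists_computable_index_wreathSum⟩
  obtain ⟨f, hf, h⟩ := exists_computable_index_wreathSum
  obtain ⟨g, hg, hgS⟩ := exists_computable_finite_W_iff hS
  have hA : ∀ e, f (g e) ∈ computableGroupIndices := fun e => by
    obtain ⟨G, hG, _⟩ := h (g e)
    exact ⟨G, hG⟩
  refine ⟨fun e => f (g e), hf.comp hg, hA, fun e => ?_⟩
  obtain ⟨G, hG, _, hfin⟩ := h (g e)
  rw [hgS, ← hfin]
  refine ⟨fun hn => ⟨hA e, G, hG, hn⟩, ?_⟩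
  rintro ⟨_, G', hG', hn⟩
  -- `G` and `G'` have the same index, so their nilpotency is the same arithmetical condition.
  exact (@IsIndexOf.isNilpotent_iff _ G hG).2 ((@IsIndexOf.isNilpotent_iff _ G' hG').1 hn)
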